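/- Theorem 4.1. All graphs are finite and simple. For a graph $G$ with at least two vertices, let $a(G)$ denote its algebraic connectivity, i.e. the second smallest eigenvalue (counted with multiplicity) of the Laplacian matrix $L(G)=D(G)-A(G)$, where $D(G)$ is the diagonal matrix of vertex degrees and $A(G)$ is the adjacency matrix. Let $G$ be a connected graph with minimum degree at least $2$ and maximum degree $\Delta$, and let $m\ge 0$ be an integer. Let $G'$ be a graph obtained from $G$ by replacing each edge $uv$ of $G$ with a path from $u$ to $v$ having at most $m$ new internal vertices (the internal vertices of different paths being distinct; their number may vary from edge to edge and may be $0$, in which case the edge is kept). Then $$a(G')\ \ge\ \frac{\min\left\{\frac{1}{\Delta}\,a(G),\,4\right\}}{2(m+1)^2}.$$ -/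

import Mathlib

namespace SimpleGraph

/-- The algebraic connectivity of a finite graph: the second smallest eigenvalue, counted with
multiplicity, of the Laplacian matrix `D - A`. Mathlib's `eigenvalues₀` lists the eigenvalues in
decreasing order, at the indices `0, …, |V| - 1`, so the second smallest is at `|V| - 2`.
The value on a graph with fewer than two vertices is a dummy value. -/
noncomputable def algebraicConnectivity {V : Type*} [Fintype V] [DecidableEq V]
    (G : SimpleGraph V) [DecidableRel G.Adj] : ℝ :=
  if h : 2 ≤ Fintype.card V then
    (G.isHermitian_lapMatrix ℝ).eigenvalues₀ ⟨Fintype.card V - 2, by omega⟩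
  else 0

/-- The vertices of the subdivision of `G` in which the edge `e` receives `n e` new vertices:
the old vertices, together with `n e` new vertices for every edge `e`. -/
abbrev SubdivVertex {V : Type*} (G : SimpleGraph V) (n : G.edgeSet → ℕ) : Type _ :=
  V ⊕ (Σ e : G.edgeSet, Fin (n e))

/-- The path that replaces the edge `e = uv`, as the sequence of its vertices: `u` at position `0`,
the new vertices of `e` at the positions `1, …, n e`, and `v` at position `n e + 1`. Which end of
`e` is called `u` is an arbitrary choice, which affects the subdivision only up to isomorphism. -/
noncomputable def subdivPath {V : Type*} (G : SimpleGraph V) (n : G.edgeSet → ℕ)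
    (e : G.edgeSet) (i : ℕ) : G.SubdivVertex n :=
  if i = 0 then Sum.inl (Quot.out e.1).1
  else if h : i - 1 < n e then Sum.inr ⟨e, ⟨i - 1, h⟩⟩
  else Sum.inl (Quot.out e.1).2

/-- The graph obtained from `G` by replacing each edge `e` with a path that has `n e` new internal
vertices: its edges join consecutive vertices of these paths. -/
def subdivide {V : Type*} (G : SimpleGraph V) (n : G.edgeSet → ℕ) :
    SimpleGraph (G.SubdivVertex n) :=
  fromEdgeSet {s | ∃ (e : G.edgeSet) (i : ℕ), i ≤ n e ∧
    s = s(G.subdivPath n e i, G.subdivPath n e (i + 1))}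

/-- `G'` is, up to isomorphism, obtained from `G` by subdividing each edge with at most `m` new
vertices; the number of new vertices may vary from edge to edge and may be zero. -/
def IsSubdivisionWithAtMost {V V' : Type*} (G : SimpleGraph V) (G' : SimpleGraph V') (m : ℕ) :
    Prop :=
  ∃ n : G.edgeSet → ℕ, (∀ e, n e ≤ m) ∧ Nonempty (G' ≃g G.subdivide n)

end SimpleGraph

open Finset Matrix

/-! ### Variational bounds for the algebraic connectivity. -/

section Spectral

variable {V : Type*} [Fintype V] [DecidableEq V] (G : SimpleGraph V) [DecidableRel G.Adj]

namespace Matrix.IsHermitian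

variable {A : Matrix V V ℝ} (hA : A.IsHermitian)

/-! Bound the Rayleigh quotient on `G'` of a mean-zero `g`. Subtracting a constant gives `y` with
mean zero on the old vertices, same energy and no smaller norm. On a path with `n` inner vertices,
energy `E` and end difference `D`, the excess `(n+1)E - D²` is nonnegative and controls the
deviation of `y` from linear interpolation, hence its inner values (`path_energy_bounds`). Summed
over edges, `‖y‖²` is at most a multiple of `Δ` times the old-vertex norm plus a multiple of the
excess. The spectral gap of `G` turns the first term into `∑ D²`, the cap `4` treats the second, and
the `D²` terms cancel (`poincare_of_iso_subdivide`). -/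

theorem sum_sq_eq_sum_inner_eigenvectorBasis_sq (f : V → ℝ) :
    f ⬝ᵥ f = ∑ i, (f ⬝ᵥ ⇑(hA.eigenvectorBasis i)) ^ 2 := by
  have h := hA.eigenvectorBasis.sum_sq_inner_left (WithLp.toLp 2 f)
  rw [EuclideanSpace.real_norm_sq_eq] at h
  simp only [EuclideanSpace.inner_eq_star_dotProduct, star_trivial] at h
  rw [dotProduct]
  simp only [← pow_two]
  rw [← h]
  simp only [dotProduct_comm f]

theorem dotProduct_mulVec_eq_sum_eigenvalues_mul (f : V → ℝ) :
    f ⬝ᵥ A *ᵥ f = ∑ i, hA.eigenvalues i * (f ⬝ᵥ ⇑(hA.eigenvectorBasis i)) ^ 2 := by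
  have h := hA.eigenvectorBasis.sum_inner_mul_inner (WithLp.toLp 2 f) (WithLp.toLp 2 (A *ᵥ f))
  simp only [EuclideanSpace.inner_eq_star_dotProduct, star_trivial] at h
  rw [dotProduct_comm, ← h]
  refine sum_congr rfl fun i _ => ?_
  have hs : Aᵀ = A := by simpa using hA.eq
  rw [dotProduct_comm (A *ᵥ f), dotProduct_mulVec, ← mulVec_transpose, hs,
    hA.mulVec_eigenvectorBasis, smul_dotProduct, smul_eq_mul, dotProduct_comm f]
  ring

theorem eigenvectorBasis_dotProduct (i j : V) :
    ⇑(hA.eigenvectorBasis i) ⬝ᵥ ⇑(hA.eigenvectorBasis j) = if i = j then 1 else 0 := by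
  have h := orthonormal_iff_ite.mp hA.eigenvectorBasis.orthonormal j i
  simp only [EuclideanSpace.inner_eq_star_dotProduct, star_trivial] at h
  simp only [h, eq_comm]

end Matrix.IsHermitian

namespace SimpleGraph

/-- The algebraic connectivity is the eigenvalue at some index, and one further index carries a
smaller eigenvalue while all others carry a larger one. -/
theorem exists_eigenvalues_eq_algebraicConnectivity (hV : 2 ≤ Fintype.card V) :
    ∃ k l : V, k ≠ l ∧ (G.isHermitian_lapMatrix ℝ).eigenvalues k = G.algebraicConnectivity ∧
      (G.isHermitian_lapMatrix ℝ).eigenvalues l ≤ G.algebraicConnectivity ∧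
      ∀ i, i ≠ l → G.algebraicConnectivity ≤ (G.isHermitian_lapMatrix ℝ).eigenvalues i := by
  set hA := G.isHermitian_lapMatrix ℝ
  let φ : Fin (Fintype.card V) ≃ V := Fintype.equivOfCardEq (Fintype.card_fin _)
  have ha : G.algebraicConnectivity = hA.eigenvalues₀ ⟨Fintype.card V - 2, by omega⟩ := by
    rw [algebraicConnectivity, dif_pos hV]
  have hev : ∀ i, hA.eigenvalues i = hA.eigenvalues₀ (φ.symm i) := fun _ => rfl
  refine ⟨φ ⟨Fintype.card V - 2, by omega⟩, φ ⟨Fintype.card V - 1, by omega⟩, ?_, ?_, ?_, ?_⟩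
  · intro h
    have := congrArg Fin.val (φ.injective h)
    simp only at this
    omega
  · rw [hev, ha, Equiv.symm_apply_apply]
  · rw [hev, ha, Equiv.symm_apply_apply]
    apply hA.eigenvalues₀_antitone
    rw [Fin.le_def]
    simp only
    omega
  · intro i hi
    rw [hev, ha]
    apply hA.eigenvalues₀_antitone
    rw [Fin.le_def]
    have h1 := (φ.symm i).isLt
    have h2 : (φ.symm i).val ≠ Fintype.card V - 1 := by
      intro h
      apply hi
      rw [← Equiv.symm_apply_eq]
      exact Fin.ext h
    simp only
    omega

theorem lapMatrix_eigenvalues_nonneg (i : V) :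
    0 ≤ (G.isHermitian_lapMatrix ℝ).eigenvalues i :=
  (posSemidef_lapMatrix ℝ G).eigenvalues_nonneg i

theorem algebraicConnectivity_nonneg : 0 ≤ G.algebraicConnectivity := by
  by_cases hV : 2 ≤ Fintype.card V
  · obtain ⟨k, l, -, hk, -⟩ := G.exists_eigenvalues_eq_algebraicConnectivity hV
    exact hk ▸ G.lapMatrix_eigenvalues_nonneg k
  · rw [algebraicConnectivity, dif_neg hV]

theorem algebraicConnectivity_mul_dotProduct_le {f : V → ℝ} (hf : ∑ v, f v = 0) :
    G.algebraicConnectivity * (f ⬝ᵥ f) ≤ f ⬝ᵥ G.lapMatrix ℝ *ᵥ f := by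
  set hA := G.isHermitian_lapMatrix ℝ
  have hpsd : 0 ≤ f ⬝ᵥ G.lapMatrix ℝ *ᵥ f := by
    rw [hA.dotProduct_mulVec_eq_sum_eigenvalues_mul]
    exact sum_nonneg fun i _ => mul_nonneg (G.lapMatrix_eigenvalues_nonneg i) (sq_nonneg _)
  -- If the value is `0`, the kernel may have dimension above one and the eigenvector at `l` need
  -- not be constant, but semidefiniteness suffices. Otherwise the kernel is spanned by the
  -- constants, so `f` is orthogonal to the eigenvector at `l`.
  rcases G.algebraicConnectivity_nonneg.eq_or_lt with h0 | hpos
  · rwa [← h0, zero_mul]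
  have hV : 2 ≤ Fintype.card V := by
    by_contra h
    rw [algebraicConnectivity, dif_neg h] at hpos
    exact lt_irrefl _ hpos
  obtain ⟨k, l, -, -, -, hl⟩ := G.exists_eigenvalues_eq_algebraicConnectivity hV
  let w : V → ℝ := fun _ => 1
  have hw : ∀ i, i ≠ l → w ⬝ᵥ ⇑(hA.eigenvectorBasis i) = 0 := by
    have h0 : w ⬝ᵥ G.lapMatrix ℝ *ᵥ w = 0 := by
      rw [G.lapMatrix_mulVec_const_eq_zero, dotProduct_zero]
    rw [hA.dotProduct_mulVec_eq_sum_eigenvalues_mul, sum_eq_zero_iff_of_nonneg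
      fun i _ => mul_nonneg (G.lapMatrix_eigenvalues_nonneg i) (sq_nonneg _)] at h0
    intro i hi
    have := h0 i (mem_univ i)
    rcases mul_eq_zero.mp this with h | h
    · exact absurd h (hpos.trans_le (hl i hi)).ne'
    · exact pow_eq_zero_iff two_ne_zero |>.mp h
  have hwl : w ⬝ᵥ ⇑(hA.eigenvectorBasis l) ≠ 0 := by
    intro h
    have h1 : w ⬝ᵥ w = 0 := by
      rw [hA.sum_sq_eq_sum_inner_eigenvectorBasis_sq]
      refine sum_eq_zero fun i _ => ?_
      rcases eq_or_ne i l with rfl | hi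
      · rw [h]; norm_num
      · rw [hw i hi]; norm_num
    have h2 : w ⬝ᵥ w = (Fintype.card V : ℝ) := by simp [w, dotProduct]
    rw [h2, Nat.cast_eq_zero] at h1
    omega
  have hfl : f ⬝ᵥ ⇑(hA.eigenvectorBasis l) = 0 := by
    have h := hA.eigenvectorBasis.sum_inner_mul_inner (WithLp.toLp 2 w) (WithLp.toLp 2 f)
    simp only [EuclideanSpace.inner_eq_star_dotProduct, star_trivial] at h
    rw [sum_eq_single l] at h
    · have h1 : f ⬝ᵥ w = 0 := by simpa [w, dotProduct] using hf
      rw [h1, dotProduct_comm _ w] at h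
      exact (mul_eq_zero.mp h).resolve_left hwl
    · intro i _ hi
      rw [dotProduct_comm, hw i hi, zero_mul]
    · simp
  rw [hA.dotProduct_mulVec_eq_sum_eigenvalues_mul, hA.sum_sq_eq_sum_inner_eigenvectorBasis_sq,
    mul_sum]
  refine sum_le_sum fun i _ => ?_
  rcases eq_or_ne i l with rfl | hi
  · rw [hfl]; norm_num
  · exact mul_le_mul_of_nonneg_right (hl i hi) (sq_nonneg _)

/-- Courant–Fischer: the span of two eigenvectors for the lowest eigenvalues contains a nonzero
mean-zero vector, whose Rayleigh quotient is at most the larger eigenvalue. -/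
theorem le_algebraicConnectivity (hV : 2 ≤ Fintype.card V) {c : ℝ}
    (h : ∀ f : V → ℝ, ∑ v, f v = 0 → c * (f ⬝ᵥ f) ≤ f ⬝ᵥ G.lapMatrix ℝ *ᵥ f) :
    c ≤ G.algebraicConnectivity := by
  obtain ⟨k, l, hkl, hk, hl, -⟩ := G.exists_eigenvalues_eq_algebraicConnectivity hV
  set hA := G.isHermitian_lapMatrix ℝ
  set x : V → ℝ := ⇑(hA.eigenvectorBasis k) with hx
  set y : V → ℝ := ⇑(hA.eigenvectorBasis l) with hy
  have hxx : x ⬝ᵥ x = 1 := by rw [hx, hA.eigenvectorBasis_dotProduct, if_pos rfl]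
  have hyy : y ⬝ᵥ y = 1 := by rw [hy, hA.eigenvectorBasis_dotProduct, if_pos rfl]
  have hxy : x ⬝ᵥ y = 0 := by rw [hx, hy, hA.eigenvectorBasis_dotProduct, if_neg hkl]
  have hyx : y ⬝ᵥ x = 0 := by rw [dotProduct_comm, hxy]
  have hLx : G.lapMatrix ℝ *ᵥ x = G.algebraicConnectivity • x := by
    rw [← hk]; exact hA.mulVec_eigenvectorBasis k
  have hLy : G.lapMatrix ℝ *ᵥ y = hA.eigenvalues l • y := hA.mulVec_eigenvectorBasis l
  obtain ⟨α, β, hαβ, hsum⟩ : ∃ α β : ℝ, 0 < α ^ 2 + β ^ 2 ∧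
      α * ∑ v, x v + β * ∑ v, y v = 0 := by
    by_cases hs : ∑ v, x v = 0
    · exact ⟨1, 0, by norm_num, by rw [hs]; ring⟩
    · exact ⟨∑ v, y v, -∑ v, x v, by rw [neg_sq]; positivity, by ring⟩
  have hf : ∑ v, (α • x + β • y) v = 0 := by
    simpa [sum_add_distrib, mul_sum] using hsum
  have h1 := h _ hf
  simp only [mulVec_add, mulVec_smul, hLx, hLy, dotProduct_add, add_dotProduct, dotProduct_smul,
    smul_dotProduct, hxx, hyy, hxy, hyx, smul_eq_mul] at h1
  nlinarith [sq_nonneg β, mul_le_mul_of_nonneg_left hl (sq_nonneg β)]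

end SimpleGraph

end Spectral

/-! ### Quadratic forms as sums over edges. -/

section EdgeSums

namespace SimpleGraph

section

variable {V : Type*} (G : SimpleGraph V)

theorem edge_eq_mk_out (e : G.edgeSet) : s((Quot.out e.1).1, (Quot.out e.1).2) = e.1 :=
  Quot.out_eq e.1

theorem adj_out (e : G.edgeSet) : G.Adj (Quot.out e.1).1 (Quot.out e.1).2 := by
  rw [← mem_edgeSet, edge_eq_mk_out]
  exact e.2

end

variable {V : Type*} [Fintype V] [DecidableEq V] (G : SimpleGraph V) [DecidableRel G.Adj]

theorem sum_sum_adj_eq_two_mul_sum_edgeSet (F : Sym2 V → ℝ) :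
    (∑ i, ∑ j, if G.Adj i j then F s(i, j) else 0) = 2 * ∑ e : G.edgeSet, F e := by
  have h1 : ∑ d : G.Dart, F d.edge = 2 * ∑ e : G.edgeSet, F e := by
    rw [← sum_fiberwise_of_maps_to (s := univ) (t := G.edgeFinset) (g := Dart.edge)
      (fun d _ => by simp [d.edge_mem]), mul_sum, Finset.sum_set_coe (f := fun e => 2 * F e)]
    refine sum_congr rfl fun e he => ?_
    rw [sum_congr rfl fun d hd => congrArg F (mem_filter.mp hd).2, sum_const,
      G.dart_edge_fiber_card e (mem_edgeFinset.mp he), nsmul_eq_mul, Nat.cast_ofNat]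
  rw [← h1, ← sum_product', ← sum_filter]
  refine sum_bij' (fun p hp => (⟨p, (mem_filter.mp hp).2⟩ : G.Dart)) (fun d _ => d.toProd)
    ?_ ?_ ?_ ?_ ?_
  · simp
  · intro d _; simp [d.adj]
  · simp
  · simp
  · intro p hp; rfl

theorem dotProduct_lapMatrix_eq_sum_edgeSet_lift (f : V → ℝ) :
    f ⬝ᵥ G.lapMatrix ℝ *ᵥ f = ∑ e : G.edgeSet,
      Sym2.lift ⟨fun u v => (f u - f v) ^ 2, fun _ _ => sub_sq_comm _ _⟩ e.1 := by
  rw [← toLinearMap₂'_apply', lapMatrix_toLinearMap₂', div_eq_iff two_ne_zero, mul_comm]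
  exact G.sum_sum_adj_eq_two_mul_sum_edgeSet
    (Sym2.lift ⟨fun u v => (f u - f v) ^ 2, fun _ _ => sub_sq_comm _ _⟩)

theorem dotProduct_lapMatrix_eq_sum_edgeSet (f : V → ℝ) :
    f ⬝ᵥ G.lapMatrix ℝ *ᵥ f =
      ∑ e : G.edgeSet, (f (Quot.out e.1).1 - f (Quot.out e.1).2) ^ 2 := by
  rw [dotProduct_lapMatrix_eq_sum_edgeSet_lift]
  refine sum_congr rfl fun e _ => ?_
  conv_lhs => rw [← G.edge_eq_mk_out e]
  rfl

theorem sum_degree_mul_sq_eq_sum_edgeSet (f : V → ℝ) :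
    ∑ v, (G.degree v : ℝ) * f v ^ 2 =
      ∑ e : G.edgeSet, (f (Quot.out e.1).1 ^ 2 + f (Quot.out e.1).2 ^ 2) := by
  let F : Sym2 V → ℝ := Sym2.lift ⟨fun u v => f u ^ 2 + f v ^ 2, fun _ _ => by ring⟩
  have h := G.sum_sum_adj_eq_two_mul_sum_edgeSet F
  have h1 : (∑ i, ∑ j, if G.Adj i j then F s(i, j) else 0) =
      (∑ i, ∑ j, if G.Adj i j then f i ^ 2 else 0) +
      ∑ i, ∑ j, if G.Adj i j then f j ^ 2 else 0 := by
    simp only [← sum_add_distrib]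
    refine sum_congr rfl fun i _ => sum_congr rfl fun j _ => ?_
    split_ifs <;> simp [F]
  have h2 : (∑ i, ∑ j, if G.Adj i j then f j ^ 2 else 0) =
      ∑ i, ∑ j, if G.Adj i j then f i ^ 2 else 0 := by
    rw [sum_comm]
    simp only [G.adj_comm]
  have h3 : (∑ i, ∑ j, if G.Adj i j then f i ^ 2 else 0) = ∑ v, (G.degree v : ℝ) * f v ^ 2 := by
    refine sum_congr rfl fun i _ => ?_
    rw [G.degree_eq_sum_if_adj, sum_mul]
    simp
  have h4 : ∑ e : G.edgeSet, F e =
      ∑ e : G.edgeSet, (f (Quot.out e.1).1 ^ 2 + f (Quot.out e.1).2 ^ 2) := by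
    refine sum_congr rfl fun e _ => ?_
    conv_lhs => rw [← G.edge_eq_mk_out e]
    rfl
  rw [h1, h2, h3, h4] at h
  linarith

end SimpleGraph

end EdgeSums

/-! ### Energy estimates on a path. -/

section Path

theorem sq_sub_le_mul_sum_sq_sub (h : ℕ → ℝ) (a d : ℕ) :
    (h a - h (a + d)) ^ 2 ≤ d * ∑ j ∈ range d, (h (a + j) - h (a + j + 1)) ^ 2 := by
  have h1 : h a - h (a + d) = ∑ j ∈ range d, (h (a + j) - h (a + j + 1)) :=
    (sum_range_sub' (fun j => h (a + j)) d).symm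
  rw [h1]
  simpa using sq_sum_le_card_mul_sum_sq (s := range d) (f := fun j => h (a + j) - h (a + j + 1))

/-- A function on a path that vanishes at both ends is bounded by its Dirichlet energy. -/
theorem sq_le_of_path_ends_eq_zero {h : ℕ → ℝ} {L i : ℕ} (hi : i ≤ L) (h0 : h 0 = 0)
    (hL : h L = 0) : h i ^ 2 ≤ L / 4 * ∑ j ∈ range L, (h j - h (j + 1)) ^ 2 := by
  obtain ⟨d, rfl⟩ := Nat.exists_eq_add_of_le hi
  have h1 := sq_sub_le_mul_sum_sq_sub h 0 i
  have h2 := sq_sub_le_mul_sum_sq_sub h i d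
  rw [sum_range_add]
  simp only [zero_add, h0, hL, sub_zero, zero_sub, neg_sq] at h1 h2
  set A := ∑ j ∈ range i, (h j - h (j + 1)) ^ 2
  set B := ∑ j ∈ range d, (h (i + j) - h (i + j + 1)) ^ 2
  have hA : 0 ≤ A := sum_nonneg fun _ _ => sq_nonneg _
  have hB : 0 ≤ B := sum_nonneg fun _ _ => sq_nonneg _
  push_cast
  have hi0 : (0 : ℝ) ≤ i := Nat.cast_nonneg i
  have hd0 : (0 : ℝ) ≤ d := Nat.cast_nonneg d
  rcases (add_nonneg hi0 hd0).eq_or_lt with hz | hp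
  · have : (i : ℝ) = 0 := by linarith
    rw [this] at h1
    have : (d : ℝ) = 0 := by linarith
    rw [this]
    simp only [zero_mul] at h1
    simpa [‹(i : ℝ) = 0›] using h1
  -- Weighting the two Cauchy–Schwarz bounds by `d` and `i` gives `(i + d) h(i)² ≤ i d (A + B)`;
  -- then `4 i d ≤ (i + d)²`.
  · refine le_of_mul_le_mul_left ?_ hp
    have h3 := mul_le_mul_of_nonneg_left h1 hd0
    have h4 := mul_le_mul_of_nonneg_left h2 hi0
    nlinarith [mul_nonneg (sq_nonneg ((i : ℝ) - d)) (add_nonneg hA hB)]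

/-- The energy of a path dominates the energy of the linear interpolation between its ends, and the
excess controls the values at the inner vertices. -/
theorem path_energy_bounds (p : ℕ → ℝ) (n : ℕ) :
    (p 0 - p (n + 1)) ^ 2 ≤ (n + 1) * ∑ j ∈ range (n + 1), (p j - p (j + 1)) ^ 2 ∧
    ∑ i ∈ range n, p (i + 1) ^ 2 ≤ 2 * n * (p 0 ^ 2 + p (n + 1) ^ 2) + (n + 1) / 2 *
      ((n + 1) * ∑ j ∈ range (n + 1), (p j - p (j + 1)) ^ 2 - (p 0 - p (n + 1)) ^ 2) := by
  have hfirst : (p 0 - p (n + 1)) ^ 2 ≤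
      (n + 1) * ∑ j ∈ range (n + 1), (p j - p (j + 1)) ^ 2 := by
    simpa using sq_sub_le_mul_sum_sq_sub p 0 (n + 1)
  refine ⟨hfirst, ?_⟩
  set E := ∑ j ∈ range (n + 1), (p j - p (j + 1)) ^ 2 with hE
  have hL : (0 : ℝ) < n + 1 := by positivity
  set D := p 0 - p (n + 1) with hD
  -- The deviation from linear interpolation vanishes at both ends, and its energy is `E` minus that
  -- of the interpolation.
  let h : ℕ → ℝ := fun i => p i - (p 0 - i / (n + 1) * D)
  have hh : ∑ j ∈ range (n + 1), (h j - h (j + 1)) ^ 2 = E - D ^ 2 / (n + 1) := by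
    have h1 : ∀ j, (h j - h (j + 1)) ^ 2 =
        (p j - p (j + 1)) ^ 2 - 2 * (D / (n + 1)) * (p j - p (j + 1)) + (D / (n + 1)) ^ 2 := by
      intro j
      simp only [h]
      push_cast
      ring
    simp only [h1]
    rw [sum_add_distrib, sum_sub_distrib, ← mul_sum, sum_range_sub', sum_const,
      card_range, nsmul_eq_mul, ← hD, ← hE]
    push_cast
    field_simp
    ring
  have key : ∀ i ∈ range n, p (i + 1) ^ 2 ≤ 2 * (p 0 ^ 2 + p (n + 1) ^ 2) +
      ((n + 1) * E - D ^ 2) / 2 := by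
    intro i hi
    have hin : i + 1 ≤ n + 1 := by have := mem_range.mp hi; omega
    have h1 := sq_le_of_path_ends_eq_zero (h := h) hin (by simp [h])
      (by simp only [h]; push_cast; rw [div_self hL.ne']; simp [D])
    rw [hh] at h1
    have h2 : ((n + 1 : ℕ) : ℝ) / 4 * (E - D ^ 2 / (n + 1)) = ((n + 1) * E - D ^ 2) / 4 := by
      push_cast
      field_simp
    rw [h2] at h1
    have hs0 : (0 : ℝ) ≤ ((i + 1 : ℕ) : ℝ) / (n + 1) := by positivity
    have hs1 : ((i + 1 : ℕ) : ℝ) / (n + 1) ≤ 1 := by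
      rw [div_le_one hL]
      exact_mod_cast hin
    have h3 : p (i + 1) = h (i + 1) + (p 0 - ((i + 1 : ℕ) : ℝ) / (n + 1) * D) := by
      simp only [h]; ring
    set s := ((i + 1 : ℕ) : ℝ) / (n + 1)
    have h4 : (p 0 - s * D) ^ 2 ≤ p 0 ^ 2 + p (n + 1) ^ 2 := by
      have : (p 0 - s * D) ^ 2 = (1 - s) * p 0 ^ 2 + s * p (n + 1) ^ 2 - s * (1 - s) * D ^ 2 := by
        simp only [D]; ring
      rw [this]
      nlinarith [mul_nonneg (mul_nonneg hs0 (sub_nonneg.mpr hs1)) (sq_nonneg D),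
        mul_nonneg hs0 (sq_nonneg (p 0)),
        mul_nonneg (sub_nonneg.mpr hs1) (sq_nonneg (p (n + 1)))]
    rw [h3]
    nlinarith [sq_nonneg (h (i + 1) - (p 0 - s * D))]
  have h5 := sum_le_sum key
  rw [sum_const, card_range, nsmul_eq_mul] at h5
  refine h5.trans ?_
  -- Enlarging the factor `n` of the excess to `n + 1` needs `hfirst`.
  nlinarith

end Path

/-! ### Comparison of a graph with its subdivision. -/

section Subdivision

namespace SimpleGraph

variable {V : Type*} (G : SimpleGraph V) (n : G.edgeSet → ℕ)

theorem subdivPath_zero (e : G.edgeSet) : G.subdivPath n e 0 = Sum.inl (Quot.out e.1).1 := by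
  simp [subdivPath]

theorem subdivPath_last (e : G.edgeSet) :
    G.subdivPath n e (n e + 1) = Sum.inl (Quot.out e.1).2 := by
  simp [subdivPath]

theorem subdivPath_succ (e : G.edgeSet) (i : Fin (n e)) :
    G.subdivPath n e (i + 1) = Sum.inr ⟨e, i⟩ := by
  simp [subdivPath]

theorem subdivPath_ne_succ (e : G.edgeSet) {i : ℕ} (hi : i ≤ n e) :
    G.subdivPath n e i ≠ G.subdivPath n e (i + 1) := by
  have := (G.adj_out e).ne
  unfold subdivPath
  split_ifs <;> simp_all <;> omega

theorem subdivide_adj_subdivPath (e : G.edgeSet) {i : ℕ} (hi : i ≤ n e) :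
    (G.subdivide n).Adj (G.subdivPath n e i) (G.subdivPath n e (i + 1)) := by
  rw [subdivide, fromEdgeSet_adj]
  exact ⟨⟨e, i, hi, rfl⟩, G.subdivPath_ne_succ n e hi⟩

/-- Ensures that path energies count no edge of the subdivision twice. An inner vertex determines
its path; a step without one is a whole edge of `G`, determined by its ends. -/
theorem subdivPath_edge_injective {e e' : G.edgeSet} {i j : ℕ} (hi : i ≤ n e) (hj : j ≤ n e')
    (h : s(G.subdivPath n e i, G.subdivPath n e (i + 1)) =
      s(G.subdivPath n e' j, G.subdivPath n e' (j + 1))) : e = e' ∧ i = j := by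
  have h1 := (G.adj_out e).ne
  have h2 := (G.adj_out e').ne
  by_cases hee : e = e'
  · subst hee
    refine ⟨rfl, ?_⟩
    unfold subdivPath at h
    split_ifs at h <;> simp_all <;> omega
  · have hne : s((Quot.out e.1).1, (Quot.out e.1).2) ≠ s((Quot.out e'.1).1, (Quot.out e'.1).2) := by
      rw [G.edge_eq_mk_out, G.edge_eq_mk_out]
      exact fun h => hee (Subtype.ext h)
    rw [ne_eq, Sym2.eq_iff] at hne
    unfold subdivPath at h
    split_ifs at h <;> simp_all <;> grind

theorem sum_path_energy_le_of_iso {V' : Type*} [Fintype V] [DecidableEq V] [DecidableRel G.Adj]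
    [Fintype V'] [DecidableEq V'] {G' : SimpleGraph V'} [DecidableRel G'.Adj]
    (φ : G' ≃g G.subdivide n) (y : V' → ℝ) :
    ∑ e : G.edgeSet, ∑ i ∈ range (n e + 1), (y (φ.symm (G.subdivPath n e i)) -
      y (φ.symm (G.subdivPath n e (i + 1)))) ^ 2 ≤ y ⬝ᵥ G'.lapMatrix ℝ *ᵥ y := by
  rw [dotProduct_lapMatrix_eq_sum_edgeSet_lift]
  set F : Sym2 V' → ℝ := Sym2.lift ⟨fun u v => (y u - y v) ^ 2, fun _ _ => sub_sq_comm _ _⟩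
  rw [Finset.sum_set_coe (f := F), sum_sigma']
  let ψ : (Σ _ : G.edgeSet, ℕ) → Sym2 V' := fun x =>
    Sym2.map φ.symm s(G.subdivPath n x.1 x.2, G.subdivPath n x.1 (x.2 + 1))
  have hinj : Set.InjOn ψ (univ.sigma fun e => range (n e + 1) : Finset (Σ _ : G.edgeSet, ℕ)) := by
    rintro ⟨e, i⟩ hi ⟨e', j⟩ hj h
    have hi' : i ≤ n e := by simpa [Nat.lt_succ_iff] using hi
    have hj' : j ≤ n e' := by simpa [Nat.lt_succ_iff] using hj
    obtain ⟨rfl, rfl⟩ := G.subdivPath_edge_injective n hi' hj'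
      (Sym2.map.injective φ.symm.injective h)
    rfl
  have h1 := sum_image (f := F) hinj
  refine (h1.symm : _ = _).trans_le (sum_le_sum_of_subset_of_nonneg ?_ ?_)
  · intro e he
    obtain ⟨⟨e, i⟩, hi, rfl⟩ := mem_image.mp he
    rw [Set.mem_toFinset]
    have hi' : i ≤ n e := by simpa [Nat.lt_succ_iff] using hi
    exact φ.symm.map_adj_iff.mpr (G.subdivide_adj_subdivPath n e hi')
  · intro e _ _
    induction e with
    | _ u v => exact sq_nonneg (y u - y v)

theorem sum_eq_sum_add_sum_subdivPath {V' : Type*} [Fintype V] [DecidableEq V]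
    [DecidableRel G.Adj] [Fintype V'] {G' : SimpleGraph V'} (φ : G' ≃g G.subdivide n)
    (y : V' → ℝ) :
    ∑ v, y v = ∑ v : V, y (φ.symm (Sum.inl v)) +
      ∑ e : G.edgeSet, ∑ i ∈ range (n e), y (φ.symm (G.subdivPath n e (i + 1))) := by
  rw [← φ.symm.toEquiv.sum_comp, Fintype.sum_sum_type, Fintype.sum_sigma]
  congr 1
  refine sum_congr rfl fun e _ => ?_
  rw [← Fin.sum_univ_eq_sum_range fun i => y (φ.symm (G.subdivPath n e (i + 1)))]
  simp only [subdivPath_succ]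
  rfl

/-- The Poincaré inequality for a subdivision, for functions whose restriction to the original
vertices has mean zero. -/
theorem poincare_of_iso_subdivide {V' : Type*} [Fintype V] [DecidableEq V] [DecidableRel G.Adj]
    [Fintype V'] [DecidableEq V'] {G' : SimpleGraph V'} [DecidableRel G'.Adj]
    {n : G.edgeSet → ℕ} {m : ℕ} (hn : ∀ e, n e ≤ m) (hΔ : 1 ≤ G.maxDegree)
    (φ : G' ≃g G.subdivide n) {y : V' → ℝ} (hy : ∑ v, y (φ.symm (Sum.inl v)) = 0) {μ : ℝ}
    (hμ0 : 0 ≤ μ) (hμa : μ ≤ G.algebraicConnectivity / G.maxDegree) (hμ4 : μ ≤ 4) :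
    μ * (y ⬝ᵥ y) ≤ 2 * ((m : ℝ) + 1) ^ 2 * (y ⬝ᵥ G'.lapMatrix ℝ *ᵥ y) := by
  let f : V → ℝ := fun v => y (φ.symm (Sum.inl v))
  let E : G.edgeSet → ℝ := fun e => ∑ i ∈ range (n e + 1), (y (φ.symm (G.subdivPath n e i)) -
      y (φ.symm (G.subdivPath n e (i + 1)))) ^ 2
  let D : G.edgeSet → ℝ := fun e => (f (Quot.out e.1).1 - f (Quot.out e.1).2) ^ 2
  let S : G.edgeSet → ℝ := fun e => f (Quot.out e.1).1 ^ 2 + f (Quot.out e.1).2 ^ 2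
  have hE : ∑ e, E e ≤ y ⬝ᵥ G'.lapMatrix ℝ *ᵥ y := G.sum_path_energy_le_of_iso n φ y
  have hD : f ⬝ᵥ G.lapMatrix ℝ *ᵥ f = ∑ e, D e := G.dotProduct_lapMatrix_eq_sum_edgeSet f
  have hK : (1 : ℝ) ≤ m + 1 := by linarith [(Nat.cast_nonneg m : (0 : ℝ) ≤ m)]
  have hΔ' : (1 : ℝ) ≤ G.maxDegree := by exact_mod_cast hΔ
  have hS : ∑ e, S e ≤ G.maxDegree * ∑ v, f v ^ 2 := by
    rw [← G.sum_degree_mul_sq_eq_sum_edgeSet f, mul_sum]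
    refine sum_le_sum fun v _ => mul_le_mul_of_nonneg_right ?_ (sq_nonneg _)
    exact_mod_cast G.degree_le_maxDegree v
  have hE0 : ∀ e, 0 ≤ E e := fun e => sum_nonneg fun _ _ => sq_nonneg _
  have hpath : ∀ e, D e ≤ (m + 1) * E e ∧
      ∑ i ∈ range (n e), y (φ.symm (G.subdivPath n e (i + 1))) ^ 2 ≤
        2 * m * S e + (m + 1) / 2 * ((m + 1) * E e - D e) := by
    intro e
    obtain ⟨h1, h2⟩ := path_energy_bounds (fun i => y (φ.symm (G.subdivPath n e i))) (n e)
    rw [subdivPath_zero, subdivPath_last] at h1 h2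
    change D e ≤ (n e + 1) * E e at h1
    change _ ≤ 2 * n e * S e + (n e + 1) / 2 * ((n e + 1) * E e - D e) at h2
    have hne : (n e : ℝ) ≤ m := by exact_mod_cast hn e
    have hn0 : (0 : ℝ) ≤ n e := Nat.cast_nonneg _
    have hle : ((n e : ℝ) + 1) * E e ≤ (m + 1) * E e :=
      mul_le_mul_of_nonneg_right (by linarith) (hE0 e)
    refine ⟨h1.trans hle, h2.trans ?_⟩
    have hS0 : 0 ≤ S e := add_nonneg (sq_nonneg _) (sq_nonneg _)
    gcongr
  have hDE : ∑ e, D e ≤ (m + 1) * ∑ e, E e := by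
    rw [mul_sum]
    exact sum_le_sum fun e _ => (hpath e).1
  have hinner : ∑ e : G.edgeSet, ∑ i ∈ range (n e), y (φ.symm (G.subdivPath n e (i + 1))) ^ 2 ≤
      2 * m * ∑ e, S e + (m + 1) / 2 * ((m + 1) * ∑ e, E e - ∑ e, D e) := by
    refine (sum_le_sum fun e _ => (hpath e).2).trans_eq ?_
    rw [sum_add_distrib, ← mul_sum, ← mul_sum, sum_sub_distrib, ← mul_sum]
  have hyy : y ⬝ᵥ y = ∑ v, f v ^ 2 +
      ∑ e : G.edgeSet, ∑ i ∈ range (n e), y (φ.symm (G.subdivPath n e (i + 1))) ^ 2 := by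
    rw [← G.sum_eq_sum_add_sum_subdivPath n φ fun v => y v ^ 2]
    simp only [dotProduct, pow_two]
  have hgap : G.algebraicConnectivity * ∑ v, f v ^ 2 ≤ ∑ e, D e := by
    have := G.algebraicConnectivity_mul_dotProduct_le (f := f) hy
    rw [hD] at this
    simpa only [dotProduct, pow_two] using this
  have hX0 : 0 ≤ ∑ v, f v ^ 2 := sum_nonneg fun _ _ => sq_nonneg _
  rw [hyy]
  generalize ∑ v, f v ^ 2 = X at *
  generalize ∑ e, S e = S' at *
  generalize ∑ e, D e = D' at *
  generalize ∑ e, E e = E' at *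
  generalize (∑ e : G.edgeSet, ∑ i ∈ range (n e), y (φ.symm (G.subdivPath n e (i + 1))) ^ 2)
    = Y at *
  generalize y ⬝ᵥ G'.lapMatrix ℝ *ᵥ y = Q at *
  rw [le_div_iff₀ (by linarith)] at hμa
  have hm0 : (0 : ℝ) ≤ m := Nat.cast_nonneg m
  have hμX : μ * G.maxDegree * X ≤ D' := (mul_le_mul_of_nonneg_right hμa hX0).trans hgap
  have h1 : X + Y ≤ 2 * (m + 1) * (G.maxDegree * X) +
      (m + 1) / 2 * ((m + 1) * E' - D') := by
    have hX : X ≤ G.maxDegree * X := le_mul_of_one_le_left hX0 hΔ'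
    have := mul_le_mul_of_nonneg_left hS (by positivity : (0 : ℝ) ≤ 2 * m)
    linarith
  calc μ * (X + Y) ≤ μ * (2 * (m + 1) * (G.maxDegree * X) +
        (m + 1) / 2 * ((m + 1) * E' - D')) := mul_le_mul_of_nonneg_left h1 hμ0
    _ = 2 * (m + 1) * (μ * G.maxDegree * X) +
        μ * ((m + 1) / 2 * ((m + 1) * E' - D')) := by ring
    -- The cap `4` makes both coefficients of `D'` equal `2(m+1)` in absolute value, so `D'`
    -- cancels.
    _ ≤ 2 * (m + 1) * D' + 4 * ((m + 1) / 2 * ((m + 1) * E' - D')) := by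
      have h0 : 0 ≤ (m + 1 : ℝ) * E' - D' := sub_nonneg.mpr hDE
      gcongr
    _ = 2 * ((m : ℝ) + 1) ^ 2 * E' := by ring
    _ ≤ 2 * ((m : ℝ) + 1) ^ 2 * Q := by gcongr

end SimpleGraph

end Subdivision

theorem theorem4p1 {V V' : Type*} [Fintype V] [DecidableEq V] [Fintype V'] [DecidableEq V']
    (G : SimpleGraph V) [DecidableRel G.Adj] (G' : SimpleGraph V') [DecidableRel G'.Adj] (m : ℕ)
    (hconn : G.Connected) (hdeg : 2 ≤ G.minDegree)
    (hsub : G.IsSubdivisionWithAtMost G' m) :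
    min (G.algebraicConnectivity / (G.maxDegree : ℝ)) 4 / (2 * ((m : ℝ) + 1) ^ 2)
      ≤ G'.algebraicConnectivity := by
  obtain ⟨n, hn, ⟨φ⟩⟩ := hsub
  obtain ⟨v⟩ := hconn.nonempty
  have hdv : 2 ≤ G.degree v := hdeg.trans (G.minDegree_le_degree v)
  have hΔ : 1 ≤ G.maxDegree := by have := G.degree_le_maxDegree v; omega
  have hV : 2 ≤ Fintype.card V := by have := G.degree_lt_card_verts v; omega
  have hV' : 2 ≤ Fintype.card V' := hV.trans <|
    Fintype.card_le_of_injective (fun v => φ.symm (Sum.inl v))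
      (φ.symm.injective.comp Sum.inl_injective)
  refine G'.le_algebraicConnectivity hV' fun g hg => ?_
  set μ := min (G.algebraicConnectivity / (G.maxDegree : ℝ)) 4 with hμ
  have hμ0 : 0 ≤ μ :=
    le_min (div_nonneg G.algebraicConnectivity_nonneg (Nat.cast_nonneg _)) (by norm_num)
  let t : ℝ := (∑ v, g (φ.symm (Sum.inl v))) / Fintype.card V
  have hV0 : (Fintype.card V : ℝ) ≠ 0 := by
    have : Fintype.card V ≠ 0 := by omega
    exact_mod_cast this
  have hy : ∑ v, (fun w => g w - t) (φ.symm (Sum.inl v)) = 0 := by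
    simp only [sum_sub_distrib, sum_const, card_univ, nsmul_eq_mul, t]
    rw [mul_div_cancel₀ _ hV0, sub_self]
  have h1 := G.poincare_of_iso_subdivide hn hΔ φ (y := fun w => g w - t) hy hμ0 (min_le_left _ _) (min_le_right _ _)
  have h2 : (fun w => g w - t) ⬝ᵥ G'.lapMatrix ℝ *ᵥ (fun w => g w - t) =
      g ⬝ᵥ G'.lapMatrix ℝ *ᵥ g := by
    simp only [SimpleGraph.dotProduct_lapMatrix_eq_sum_edgeSet, sub_sub_sub_cancel_right]
  -- The cross term vanishes because `g` has mean zero on all of `V'`, while `t` is its mean over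
  -- the old vertices only.
  have h3 : g ⬝ᵥ g ≤ (fun w => g w - t) ⬝ᵥ (fun w => g w - t) := by
    have : (fun w => g w - t) ⬝ᵥ (fun w => g w - t) =
        g ⬝ᵥ g - 2 * t * ∑ w, g w + Fintype.card V' * t ^ 2 := by
      simp only [dotProduct, mul_sum, ← card_univ, ← nsmul_eq_mul, ← sum_const]
      rw [← sum_sub_distrib, ← sum_add_distrib]
      exact sum_congr rfl fun _ _ => by ring
    rw [this, hg]
    have : 0 ≤ (Fintype.card V' : ℝ) * t ^ 2 := by positivity
    linarith
  rw [h2] at h1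
  rw [div_mul_eq_mul_div, div_le_iff₀ (by positivity), mul_comm _ (2 * _)]
  exact (mul_le_mul_of_nonneg_left h3 hμ0).trans h1
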